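/- Let $A=(l_1,\dots,l_m)$ be a monomial curve in $\mathbb A^m$, given by positive integers $l_1,\dots,l_m$ and regarded as a $1\times m$ matrix, and let $\mathbb k$ be any field. For an integer matrix $C$ with $n$ columns and nonnegative entries, a *Markov basis* of $C$ is a finite set $M\subseteq\ker_{\mathbb Z}(C)$ such that any two $w,u\in\mathbb N^n$ with $w-u\in\ker_{\mathbb Z}(C)$ can be joined by a finite sequence $w=t_0,t_1,\dots,t_s=u$ in $\mathbb N^n$ with $t_{p-1}-t_p\in M\cup(-M)$ for all $p$; it is *minimal* if no proper subset of it is a Markov basis. The *universal Markov basis* of $C$ is the union of all its minimal Markov bases. For $r\ge 2$ let $A^{(r)}$ be the $r$-th Lawrence lifting of $A$, i.e. the $(r+m)\times rm$ matrix with $r$ diagonal blocks $A$ on top of the row $(I_m\ I_m\ \cdots\ I_m)$; vectors in $\ker_{\mathbb Z}(A^{(r)})$ are viewed as $r\times m$ matrices, and the *type* of such a vector is its number of nonzero rows. The *Markov complexity* of $A$ is the largest type of a vector in the universal Markov basis of $A^{(r)}$, as $r\ge 2$ varies. If the Markov complexity of $A$ is equal to $2$, then for all $i,j,k\in\{1,\dots,m\}$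 the monomial curve $(l_i,l_j,l_k)$ in $\mathbb A^3$ is a complete intersection. That is, its toric ideal, the kernel of $\mathbb k[x_1,x_2,x_3]\to\mathbb k[t]$, $x_1\mapsto t^{l_i}$, $x_2\mapsto t^{l_j}$, $x_3\mapsto t^{l_k}$, can be generated by as many elements as its height. -/

import Mathlib

namespace MarkovBases

/-- The lattice `Ker_ℤ(A) ⊆ ℤ^κ` of a matrix `A` with natural number entries. -/
def kerLattice {ι κ : Type*} [Fintype κ] (A : Matrix ι κ ℕ) : AddSubgroup (κ → ℤ) where
  carrier := {u | (A.map (fun a : ℕ => (a : ℤ))).mulVec u = 0}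
  add_mem' := by
    intro a b ha hb
    simp only [Set.mem_ofPred_eq] at ha hb ⊢
    rw [Matrix.mulVec_add, ha, hb, add_zero]
  zero_mem' := Matrix.mulVec_zero _
  neg_mem' := by
    intro a ha
    simp only [Set.mem_ofPred_eq] at ha ⊢
    rw [Matrix.mulVec_neg, ha, neg_zero]

/-- One move along `M`: the nonnegative vectors `w` and `t` differ by an element of `M`,
up to sign. -/
def Move {κ : Type*} (M : Set (κ → ℤ)) (w t : κ → ℕ) : Prop :=
  ∃ v ∈ M, (∀ j, (w j : ℤ) - t j = v j) ∨ (∀ j, (w j : ℤ) - t j = -v j)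

/-- `M` is a Markov basis of `A`: a finite subset of `Ker_ℤ(A)` whose moves connect any two
nonnegative integer vectors of the same fiber by a path that stays inside `ℕ^κ`. -/
def IsMarkovBasis {ι κ : Type*} [Fintype κ] (A : Matrix ι κ ℕ) (M : Set (κ → ℤ)) : Prop :=
  M.Finite ∧ M ⊆ kerLattice A ∧
    ∀ w u : κ → ℕ, (fun j => (w j : ℤ) - u j) ∈ kerLattice A →
      Relation.ReflTransGen (Move M) w u

/-- A Markov basis is minimal if no proper subset of it is a Markov basis. -/
def IsMinimalMarkovBasis {ι κ : Type*} [Fintype κ] (A : Matrix ι κ ℕ)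
    (M : Set (κ → ℤ)) : Prop :=
  Minimal (IsMarkovBasis A) M

/-- The universal Markov basis of `A`: the union of all minimal Markov bases of `A`.
(This set is closed under negation; each of its elements stands for its pair `± u`.) -/
def universalMarkovBasis {ι κ : Type*} [Fintype κ] (A : Matrix ι κ ℕ) : Set (κ → ℤ) :=
  {u | ∃ M : Set (κ → ℤ), IsMinimalMarkovBasis A M ∧ u ∈ M}

/-- The `r`-th Lawrence lifting `A^(r)`: `r` diagonal blocks `A` on top of a row of `r`
identity blocks. Columns are indexed by pairs (block, column of `A`). -/
def lawrenceLifting {ι κ : Type*} [DecidableEq κ] (A : Matrix ι κ ℕ) (r : ℕ) :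
    Matrix ((Fin r × ι) ⊕ κ) (Fin r × κ) ℕ :=
  Matrix.of (Sum.elim
    (fun (p : Fin r × ι) (q : Fin r × κ) => if p.1 = q.1 then A p.2 q.2 else 0)
    (fun (j : κ) (q : Fin r × κ) => if j = q.2 then 1 else 0))

/-- The type of a vector of `ℤ^(r × κ)`, seen as a matrix with `r` rows:
the number of its nonzero rows. -/
noncomputable def type {κ : Type*} {r : ℕ} (u : Fin r × κ → ℤ) : ℕ :=
  {p : Fin r | ∃ j, u (p, j) ≠ 0}.ncard

/-- The Markov complexity of `A`: the largest type of a vector in the universal Markov basis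
of `A^(r)`, as `r ≥ 2` varies. The supremum is taken in `ℕ∞`, where it is `⊤` for an unbounded
set of types and the maximum for a nonempty bounded one. -/
noncomputable def markovComplexity {ι κ : Type*} [Fintype κ] [DecidableEq κ]
    (A : Matrix ι κ ℕ) : ℕ∞ :=
  ⨆ (r : ℕ) (_ : 2 ≤ r) (u : Fin r × κ → ℤ)
    (_ : u ∈ universalMarkovBasis (lawrenceLifting A r)), (type u : ℕ∞)

/-- The toric ideal of `A` over `k`: the kernel of the `k`-algebra homomorphism
`k[x_j : j ∈ κ] → k[t_i : i ∈ ι]` sending `x_j` to the monomial `∏ i, t_i ^ A i j`. -/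
noncomputable def toricIdeal (k : Type*) [Field k] {ι κ : Type*} [Fintype ι]
    (A : Matrix ι κ ℕ) : Ideal (MvPolynomial κ k) :=
  RingHom.ker (MvPolynomial.aeval (R := k)
    (fun j : κ => ∏ i : ι, (MvPolynomial.X i : MvPolynomial ι k) ^ A i j))

/-- An ideal is a complete intersection if it can be generated by as many elements as its
height. -/
def IsCompleteIntersection {R : Type*} [CommRing R] (I : Ideal R) : Prop :=
  ∃ s : Finset R, Ideal.span (s : Set R) = I ∧ (s.card : ℕ∞) = I.height

/-- The `1 × m` matrix `(l_1, …, l_m)` of the monomial curve `t ↦ (t^{l_1}, …, t^{l_m})`. -/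
def curveMatrix {m : ℕ} (l : Fin m → ℕ) : Matrix (Fin 1) (Fin m) ℕ :=
  Matrix.of (fun _ j => l j)

end MarkovBases

namespace MarkovBases

/-! For three of the weights, call them n₁, n₂, n₃, let cᵢ be the least positive integer with cᵢnᵢ
in the semigroup generated by the other two. The proof splits on whether the three numbers cᵢnᵢ are
pairwise different.

If two of them coincide, say c₁n₁ = c₂n₂, then x^c₁ - y^c₂ and z^c₃ - x^a y^b generate the toric
ideal: modulo them every monomial has a normal form determined by its weight (`normal_form_unique`).
As the height is at least 2, this is a complete intersection.

If all are different, Herzog's relations hold (`exists_herzog_relations`): each cᵢnᵢ has a unique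
expression through the other two weights, with positive coefficients, and the three relations add up
to zero. Stacked as rows they form a vector of the third Lawrence lifting whose fiber has exactly
two elements, so every Markov basis contains it up to sign. Its type is 3, hence the complexity is
not 2 (`three_le_markovComplexity`). -/

/-- `c` is the least positive integer such that `c * n` lies in the semigroup generated by
`p` and `q`. -/
def IsLeastMultiple (p q n c : ℕ) : Prop :=
  IsLeast {c : ℕ | 0 < c ∧ ∃ a b : ℕ, c * n = a * p + b * q} c

/-! ### Least multiples of one weight in the semigroup of two others. -/

namespace IsLeastMultiple

variable {p q n c : ℕ}

theorem symm (h : IsLeastMultiple p q n c) : IsLeastMultiple q p n c := by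
  refine ⟨?_, fun d hd => h.2 ?_⟩
  · obtain ⟨h0, a, b, hab⟩ := h.1
    exact ⟨h0, b, a, by rw [hab, add_comm]⟩
  · obtain ⟨h0, a, b, hab⟩ := hd
    exact ⟨h0, b, a, by rw [hab, add_comm]⟩

theorem exists_of_pos (hp : 0 < p) : ∃ c, IsLeastMultiple p q n c := by
  classical
  have h : ∃ c : ℕ, 0 < c ∧ ∃ a b : ℕ, c * n = a * p + b * q :=
    ⟨p, hp, n, 0, by ring⟩
  exact ⟨Nat.find h, Nat.find_spec h, fun d hd => Nat.find_min' h hd⟩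

theorem pos (h : IsLeastMultiple p q n c) : 0 < c := h.1.1

theorem exists_eq (h : IsLeastMultiple p q n c) : ∃ a b : ℕ, c * n = a * p + b * q := h.1.2

theorem le (h : IsLeastMultiple p q n c) {x y z : ℤ} (hx : 0 < x) (hy : 0 ≤ y) (hz : 0 ≤ z)
    (e : x * n = y * p + z * q) : (c : ℤ) ≤ x := by
  lift x to ℕ using hx.le
  lift y to ℕ using hy
  lift z to ℕ using hz
  exact_mod_cast h.2 ⟨by exact_mod_cast hx, y, z, by exact_mod_cast e⟩

/-- If `n = p` then the least multiple is `1`. -/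
theorem eq_one (h : IsLeastMultiple p q p c) : c = 1 := by
  have := h.2 (show 1 ∈ _ from ⟨one_pos, 1, 0, by ring⟩)
  have := h.pos
  omega

/-- A vector of weight `c * n` is either `c` times the first unit vector or does not involve the
first variable. -/
theorem eq_or_eq_zero (h : IsLeastMultiple p q n c) (hn : 0 < n) (hp : 0 < p) (hq : 0 < q)
    {a b d : ℕ} (e : a * n + b * p + d * q = c * n) :
    (a = c ∧ b = 0 ∧ d = 0) ∨ (a = 0 ∧ b * p + d * q = c * n) := by
  rcases Nat.eq_zero_or_pos a with rfl | ha
  · right; exact ⟨rfl, by simpa using e⟩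
  left
  have hac : a ≤ c := by
    refine Nat.le_of_mul_le_mul_right ?_ hn
    omega
  rcases hac.lt_or_eq with hlt | rfl
  -- For 0 < a < c, cancelling a · n leaves a smaller positive multiple of n in the semigroup.
  · have := h.le (x := (c : ℤ) - a) (y := b) (z := d) (by omega) (by omega) (by omega) (by
      have : (a * n + b * p + d * q : ℤ) = c * n := by exact_mod_cast e
      linear_combination -this)
    omega
  · have hbp : b * p = 0 := by omega
    have hdq : d * q = 0 := by omega
    exact ⟨rfl, by simpa [hp.ne'] using hbp, by simpa [hq.ne'] using hdq⟩

end IsLeastMultiple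

/-! ### Herzog's relations between three weights. -/

section Triple

variable {n₁ n₂ n₃ c₁ c₂ c₃ : ℕ}

/-- A relation all of whose coefficients are smaller than the least multiples is trivial. -/
theorem eq_zero_of_abs_lt (hn₁ : 0 < n₁) (hn₂ : 0 < n₂) (hn₃ : 0 < n₃)
    (h₁ : IsLeastMultiple n₂ n₃ n₁ c₁) (h₂ : IsLeastMultiple n₁ n₃ n₂ c₂)
    (h₃ : IsLeastMultiple n₁ n₂ n₃ c₃) {x y z : ℤ} (e : x * n₁ + y * n₂ + z * n₃ = 0)
    (hx : |x| < c₁) (hy : |y| < c₂) (hz : |z| < c₃) : x = 0 ∧ y = 0 ∧ z = 0 := by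
  rw [abs_lt] at hx hy hz
  -- By signs, either one entry is opposite to the other two, and minimality bounds it below, or all
  -- entries share a weak sign and positivity of the weights makes them vanish.
  have f₁ : ¬ (0 < x ∧ y ≤ 0 ∧ z ≤ 0) := fun ⟨a, b, c⟩ => by
    have := h₁.le (x := x) (y := -y) (z := -z) a (by omega) (by omega) (by linarith)
    omega
  have f₂ : ¬ (0 < y ∧ x ≤ 0 ∧ z ≤ 0) := fun ⟨a, b, c⟩ => by
    have := h₂.le (x := y) (y := -x) (z := -z) a (by omega) (by omega) (by linarith)
    omega
  have f₃ : ¬ (0 < z ∧ x ≤ 0 ∧ y ≤ 0) := fun ⟨a, b, c⟩ => by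
    have := h₃.le (x := z) (y := -x) (z := -y) a (by omega) (by omega) (by linarith)
    omega
  have g₁ : ¬ (x < 0 ∧ 0 ≤ y ∧ 0 ≤ z) := fun ⟨a, b, c⟩ => by
    have := h₁.le (x := -x) (y := y) (z := z) (by omega) (by omega) (by omega) (by linarith)
    omega
  have g₂ : ¬ (y < 0 ∧ 0 ≤ x ∧ 0 ≤ z) := fun ⟨a, b, c⟩ => by
    have := h₂.le (x := -y) (y := x) (z := z) (by omega) (by omega) (by omega) (by linarith)
    omega
  have g₃ : ¬ (z < 0 ∧ 0 ≤ x ∧ 0 ≤ y) := fun ⟨a, b, c⟩ => by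
    have := h₃.le (x := -z) (y := x) (z := y) (by omega) (by omega) (by omega) (by linarith)
    omega
  have k : ∀ x y z : ℤ, x * n₁ + y * n₂ + z * n₃ = 0 → 0 ≤ x → 0 ≤ y → 0 ≤ z →
      x = 0 ∧ y = 0 ∧ z = 0 := fun x y z e a b c => by
    have ha : 0 ≤ x * n₁ := by positivity
    have hb : 0 ≤ y * n₂ := by positivity
    have hc : 0 ≤ z * n₃ := by positivity
    refine ⟨?_, ?_, ?_⟩
    · have : x * n₁ = 0 := by linarith
      simpa [hn₁.ne'] using this
    · have : y * n₂ = 0 := by linarith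
      simpa [hn₂.ne'] using this
    · have : z * n₃ = 0 := by linarith
      simpa [hn₃.ne'] using this
  have k₁ := k x y z e
  have k₂ := k (-x) (-y) (-z) (by linarith)
  omega

/-- If the least multiple of `n₁` is a multiple of `n₂` alone but not the least one, then the
least multiple of `n₂` is a smaller multiple of `n₃` alone. -/
theorem eq_zero_and_lt_of_eq_mul (hn₁ : 0 < n₁) (hn₂ : 0 < n₂)
    (h₁ : IsLeastMultiple n₂ n₃ n₁ c₁) (h₂ : IsLeastMultiple n₁ n₃ n₂ c₂)
    (hne : c₁ * n₁ ≠ c₂ * n₂) {a b d : ℕ} (ha : c₁ * n₁ = a * n₂)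
    (hb : c₂ * n₂ = b * n₁ + d * n₃) : b = 0 ∧ c₂ * n₂ < c₁ * n₁ := by
  have hc₁ := h₁.pos
  have ha0 : 0 < a := by
    rcases Nat.eq_zero_or_pos a with rfl | h
    · have : 0 < c₁ * n₁ := by positivity
      omega
    · exact h
  have hca : c₂ ≤ a := h₂.2 ⟨ha0, c₁, 0, by rw [← ha]; ring⟩
  have hca' : c₂ < a := lt_of_le_of_ne hca (by rintro rfl; exact hne ha)
  have hlt : c₂ * n₂ < c₁ * n₁ := by rw [ha]; exact Nat.mul_lt_mul_of_pos_right hca' hn₂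
  refine ⟨?_, hlt⟩
  -- If b > 0, then (c₁ - b)n₁ = (a - c₂)n₂ + d n₃ contradicts the minimality of c₁.
  by_contra hb0
  have hcb : b < c₁ := by
    refine Nat.lt_of_mul_lt_mul_right (a := n₁) ?_
    omega
  have ha' : (c₁ * n₁ : ℤ) = a * n₂ := by exact_mod_cast ha
  have hb' : (c₂ * n₂ : ℤ) = b * n₁ + d * n₃ := by exact_mod_cast hb
  have := h₁.le (x := (c₁ : ℤ) - b) (y := (a : ℤ) - c₂) (z := d) (by omega) (by omega)
    (by omega) (by linear_combination ha' + hb')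
  omega

/-- Applying `eq_zero_and_lt_of_eq_mul` around the cycle 1 → 2 → 3 → 1 would give c₁n₁ > c₂n₂ > c₃n₃
> c₁n₁. -/
theorem ne_mul_of_ne (hn₁ : 0 < n₁) (hn₂ : 0 < n₂) (hn₃ : 0 < n₃)
    (h₁ : IsLeastMultiple n₂ n₃ n₁ c₁) (h₂ : IsLeastMultiple n₁ n₃ n₂ c₂)
    (h₃ : IsLeastMultiple n₁ n₂ n₃ c₃) (h₁₂ : c₁ * n₁ ≠ c₂ * n₂) (h₁₃ : c₁ * n₁ ≠ c₃ * n₃)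
    (h₂₃ : c₂ * n₂ ≠ c₃ * n₃) (a : ℕ) : c₁ * n₁ ≠ a * n₂ := by
  intro ha
  obtain ⟨b, d, hb⟩ := h₂.exists_eq
  obtain ⟨rfl, hlt₁⟩ := eq_zero_and_lt_of_eq_mul hn₁ hn₂ h₁ h₂ h₁₂ ha hb
  rw [zero_mul, zero_add] at hb
  obtain ⟨f, g, hf⟩ := h₃.symm.exists_eq
  obtain ⟨rfl, hlt₂⟩ := eq_zero_and_lt_of_eq_mul hn₂ hn₃ h₂.symm h₃.symm h₂₃ hb hf
  rw [zero_mul, zero_add] at hf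
  obtain ⟨f', g', hf'⟩ := h₁.symm.exists_eq
  obtain ⟨rfl, hlt₃⟩ := eq_zero_and_lt_of_eq_mul hn₃ hn₁ h₃ h₁.symm h₁₃.symm hf hf'
  omega

theorem pos_of_ne (hn₁ : 0 < n₁) (hn₂ : 0 < n₂) (hn₃ : 0 < n₃)
    (h₁ : IsLeastMultiple n₂ n₃ n₁ c₁) (h₂ : IsLeastMultiple n₁ n₃ n₂ c₂)
    (h₃ : IsLeastMultiple n₁ n₂ n₃ c₃) (h₁₂ : c₁ * n₁ ≠ c₂ * n₂) (h₁₃ : c₁ * n₁ ≠ c₃ * n₃)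
    (h₂₃ : c₂ * n₂ ≠ c₃ * n₃) {a b : ℕ} (e : c₁ * n₁ = a * n₂ + b * n₃) : 0 < a ∧ 0 < b := by
  constructor
  · rcases Nat.eq_zero_or_pos a with rfl | h
    · exact absurd (by simpa using e)
        (ne_mul_of_ne hn₁ hn₃ hn₂ h₁.symm h₃ h₂ h₁₃ h₁₂ h₂₃.symm b)
    · exact h
  · rcases Nat.eq_zero_or_pos b with rfl | h
    · exact absurd (by simpa using e) (ne_mul_of_ne hn₁ hn₂ hn₃ h₁ h₂ h₃ h₁₂ h₁₃ h₂₃ a)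
    · exact h

/-- The coefficients of the relation of the first variable are smaller than the least multiple
of the second one. -/
theorem lt_of_pos (hn₂ : 0 < n₂) (hn₃ : 0 < n₃) (h₁ : IsLeastMultiple n₂ n₃ n₁ c₁)
    {a b d f : ℕ} (e₁ : c₁ * n₁ = a * n₂ + b * n₃) (e₂ : c₂ * n₂ = d * n₁ + f * n₃)
    (hb : 0 < b) (hd : 0 < d) : a < c₂ := by
  by_contra hac
  push Not at hac
  have e₁' : (c₁ * n₁ : ℤ) = a * n₂ + b * n₃ := by exact_mod_cast e₁
  have e₂' : (c₂ * n₂ : ℤ) = d * n₁ + f * n₃ := by exact_mod_cast e₂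
  have key : ((c₁ : ℤ) - d) * n₁ = ((a : ℤ) - c₂) * n₂ + ((b : ℤ) + f) * n₃ := by
    linear_combination e₁' + e₂'
  have hac' : (0 : ℤ) ≤ (a : ℤ) - c₂ := by omega
  -- Here b > 0 makes c₁ - d positive, while d > 0 makes it smaller than c₁.
  have hpos : (0 : ℤ) < ((c₁ : ℤ) - d) * n₁ := by
    rw [key]; positivity
  have := h₁.le (pos_of_mul_pos_left hpos (by omega)) hac' (by omega) key
  omega

/-- Herzog's description of the relations of three positive integers whose least multiples are
pairwise different. -/
theorem exists_herzog_relations (hn₁ : 0 < n₁) (hn₂ : 0 < n₂) (hn₃ : 0 < n₃)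
    (h₁ : IsLeastMultiple n₂ n₃ n₁ c₁) (h₂ : IsLeastMultiple n₁ n₃ n₂ c₂)
    (h₃ : IsLeastMultiple n₁ n₂ n₃ c₃) (h₁₂ : c₁ * n₁ ≠ c₂ * n₂) (h₁₃ : c₁ * n₁ ≠ c₃ * n₃)
    (h₂₃ : c₂ * n₂ ≠ c₃ * n₃) :
    ∃ r₁₂ r₁₃ r₂₁ r₂₃ r₃₁ r₃₂ : ℕ,
      (0 < r₁₂ ∧ 0 < r₁₃ ∧ 0 < r₂₁ ∧ 0 < r₂₃ ∧ 0 < r₃₁ ∧ 0 < r₃₂) ∧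
      (r₂₁ + r₃₁ = c₁ ∧ r₁₂ + r₃₂ = c₂ ∧ r₁₃ + r₂₃ = c₃) ∧
      (∀ a b : ℕ, a * n₂ + b * n₃ = c₁ * n₁ ↔ a = r₁₂ ∧ b = r₁₃) ∧
      (∀ a b : ℕ, a * n₁ + b * n₃ = c₂ * n₂ ↔ a = r₂₁ ∧ b = r₂₃) ∧
      (∀ a b : ℕ, a * n₁ + b * n₂ = c₃ * n₃ ↔ a = r₃₁ ∧ b = r₃₂) := by
  obtain ⟨r₁₂, r₁₃, e₁⟩ := h₁.exists_eq
  obtain ⟨r₂₁, r₂₃, e₂⟩ := h₂.exists_eq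
  obtain ⟨r₃₁, r₃₂, e₃⟩ := h₃.exists_eq
  have P₁ := fun {a b} => pos_of_ne (a := a) (b := b) hn₁ hn₂ hn₃ h₁ h₂ h₃ h₁₂ h₁₃ h₂₃
  have P₂ := fun {a b} => pos_of_ne (a := a) (b := b) hn₂ hn₁ hn₃ h₂ h₁ h₃.symm h₁₂.symm h₂₃ h₁₃
  have P₃ := fun {a b} => pos_of_ne (a := a) (b := b) hn₃ hn₁ hn₂ h₃ h₁.symm h₂.symm
    h₁₃.symm h₂₃.symm h₁₂
  have swap : ∀ {x a b : ℕ}, x = a + b → x = b + a := fun h => h.trans (add_comm _ _)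
  -- The bounds are proved for every representation, not only the chosen one; uniqueness below
  -- compares two of them.
  have L₁ : ∀ {a b : ℕ}, c₁ * n₁ = a * n₂ + b * n₃ → a < c₂ ∧ b < c₃ := fun {a b} e =>
    ⟨lt_of_pos hn₂ hn₃ h₁ e e₂ (P₁ e).2 (P₂ e₂).1,
      lt_of_pos hn₃ hn₂ h₁.symm (swap e) e₃ (P₁ e).1 (P₃ e₃).1⟩
  have L₂ : ∀ {a b : ℕ}, c₂ * n₂ = a * n₁ + b * n₃ → a < c₁ ∧ b < c₃ := fun {a b} e =>
    ⟨lt_of_pos hn₁ hn₃ h₂ e e₁ (P₂ e).2 (P₁ e₁).1,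
      lt_of_pos hn₃ hn₁ h₂.symm (swap e) (swap e₃) (P₂ e).1 (P₃ e₃).2⟩
  have L₃ : ∀ {a b : ℕ}, c₃ * n₃ = a * n₁ + b * n₂ → a < c₁ ∧ b < c₂ := fun {a b} e =>
    ⟨lt_of_pos hn₁ hn₂ h₃ e (swap e₁) (P₃ e).2 (P₁ e₁).2,
      lt_of_pos hn₂ hn₁ h₃.symm (swap e) (swap e₂) (P₃ e).1 (P₂ e₂).2⟩
  have Z := fun {x y z} => eq_zero_of_abs_lt (x := x) (y := y) (z := z) hn₁ hn₂ hn₃ h₁ h₂ h₃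
  have hp₁ := P₁ e₁
  have hp₂ := P₂ e₂
  have hp₃ := P₃ e₃
  have hl₁ := L₁ e₁
  have hl₂ := L₂ e₂
  have hl₃ := L₃ e₃
  have hc₁ := h₁.pos
  have hc₂ := h₂.pos
  have hc₃ := h₃.pos
  have e₁' : (c₁ * n₁ : ℤ) = r₁₂ * n₂ + r₁₃ * n₃ := by exact_mod_cast e₁
  have e₂' : (c₂ * n₂ : ℤ) = r₂₁ * n₁ + r₂₃ * n₃ := by exact_mod_cast e₂
  have e₃' : (c₃ * n₃ : ℤ) = r₃₁ * n₁ + r₃₂ * n₂ := by exact_mod_cast e₃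
  refine ⟨r₁₂, r₁₃, r₂₁, r₂₃, r₃₁, r₃₂, by tauto, ?_, fun a b => ⟨fun e => ?_, ?_⟩,
    fun a b => ⟨fun e => ?_, ?_⟩, fun a b => ⟨fun e => ?_, ?_⟩⟩
  -- In the sum of the three relations each coefficient is below the least multiple in absolute
  -- value, because 0 < rᵢⱼ < cⱼ.
  · have := Z (x := r₂₁ + r₃₁ - c₁) (y := r₁₂ + r₃₂ - c₂) (z := r₁₃ + r₂₃ - c₃)
      (by linear_combination -e₁' - e₂' - e₃') (by rw [abs_lt]; omega) (by rw [abs_lt]; omega)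
      (by rw [abs_lt]; omega)
    omega
  · have hl := L₁ e.symm
    have e' : (a * n₂ + b * n₃ : ℤ) = c₁ * n₁ := by exact_mod_cast e
    have := Z (x := 0) (y := a - r₁₂) (z := b - r₁₃) (by linear_combination e' + e₁')
      (by rw [abs_lt]; omega) (by rw [abs_lt]; omega) (by rw [abs_lt]; omega)
    omega
  · rintro ⟨rfl, rfl⟩
    exact e₁.symm
  · have hl := L₂ e.symm
    have e' : (a * n₁ + b * n₃ : ℤ) = c₂ * n₂ := by exact_mod_cast e
    have := Z (x := a - r₂₁) (y := 0) (z := b - r₂₃) (by linear_combination e' + e₂')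
      (by rw [abs_lt]; omega) (by rw [abs_lt]; omega) (by rw [abs_lt]; omega)
    omega
  · rintro ⟨rfl, rfl⟩
    exact e₂.symm
  · have hl := L₃ e.symm
    have e' : (a * n₁ + b * n₂ : ℤ) = c₃ * n₃ := by exact_mod_cast e
    have := Z (x := a - r₃₁) (y := b - r₃₂) (z := 0) (by linear_combination e' + e₃')
      (by rw [abs_lt]; omega) (by rw [abs_lt]; omega) (by rw [abs_lt]; omega)
    omega
  · rintro ⟨rfl, rfl⟩
    exact e₃.symm

end Triple

/-! ### Existence of minimal Markov bases, by way of the Graver basis. -/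

section Graver

variable {κ : Type*} [Finite κ]

/-- `u` conforms to `v`: every entry of `u` lies between `0` and the entry of `v`. -/
def Conforms {κ : Type*} (u v : κ → ℤ) : Prop :=
  ∀ j, (u j).toNat ≤ (v j).toNat ∧ (-u j).toNat ≤ (-v j).toNat

/-- Dickson's lemma, applied to the pairs of positive and negative parts. -/
theorem exists_conforms_of_not_finite (s : Set (κ → ℤ)) (hs : ¬ s.Finite) :
    ∃ u ∈ s, ∃ v ∈ s, u ≠ v ∧ Conforms u v := by
  have hinf : Infinite s := Set.infinite_coe_iff.mpr hs
  let f : ℕ ↪ s := Infinite.natEmbedding s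
  obtain ⟨a, b, hab, hle⟩ := wellQuasiOrdered_le (α := κ → ℕ × ℕ)
    (fun n j => (((f n : κ → ℤ) j).toNat, (-(f n : κ → ℤ) j).toNat))
  refine ⟨f a, (f a).2, f b, (f b).2, fun h => hab.ne (f.injective (Subtype.ext h)), fun j => ?_⟩
  exact hle j

end Graver

variable {ι κ : Type*} [Fintype κ]

/-- The Graver basis: the nonzero elements of the kernel lattice that are minimal for
conformity. -/
def graverBasis (A : Matrix ι κ ℕ) : Set (κ → ℤ) :=
  {u | u ∈ kerLattice A ∧ u ≠ 0 ∧ ∀ v ∈ kerLattice A, v ≠ 0 → Conforms v u → v = u}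

theorem graverBasis_finite (A : Matrix ι κ ℕ) : (graverBasis A).Finite := by
  by_contra h
  obtain ⟨u, hu, v, hv, hne, hc⟩ := exists_conforms_of_not_finite _ h
  exact hne (hv.2.2 u hu.1 hu.2.1 hc)

theorem sum_natAbs_lt_of_conforms {u v : κ → ℤ} (h : Conforms u v) (hne : u ≠ v) :
    ∑ j, (u j).natAbs < ∑ j, (v j).natAbs := by
  obtain ⟨j, hj⟩ := Function.ne_iff.mp hne
  refine Finset.sum_lt_sum (fun i _ => ?_) ⟨j, Finset.mem_univ j, ?_⟩
  · have := h i
    omega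
  · have := h j
    omega

theorem exists_mem_graverBasis_conforms (A : Matrix ι κ ℕ) {v : κ → ℤ} (hv : v ∈ kerLattice A)
    (hv0 : v ≠ 0) : ∃ g ∈ graverBasis A, Conforms g v := by
  induction hN : ∑ j, (v j).natAbs using Nat.strong_induction_on generalizing v with
  | _ N ih =>
    by_cases hg : v ∈ graverBasis A
    · exact ⟨v, hg, fun j => ⟨le_rfl, le_rfl⟩⟩
    · have : ∃ u ∈ kerLattice A, u ≠ 0 ∧ Conforms u v ∧ u ≠ v := by
        by_contra hcon
        push Not at hcon
        exact hg ⟨hv, hv0, hcon⟩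
      obtain ⟨u, hu, hu0, hc, hne⟩ := this
      obtain ⟨g, hg, hgu⟩ := ih _ (hN ▸ sum_natAbs_lt_of_conforms hc hne) hu hu0 rfl
      exact ⟨g, hg, fun j => ⟨(hgu j).1.trans (hc j).1, (hgu j).2.trans (hc j).2⟩⟩

/-- If a Graver element g conforms to w - u, then w - g is still nonnegative and closer to u in the
1-norm. -/
theorem graverBasis_isMarkovBasis (A : Matrix ι κ ℕ) : IsMarkovBasis A (graverBasis A) := by
  refine ⟨graverBasis_finite A, fun u hu => hu.1, fun w u hwu => ?_⟩
  induction hN : ∑ j, ((w j : ℤ) - u j).natAbs using Nat.strong_induction_on generalizing w with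
  | _ N ih =>
    by_cases h0 : (fun j => (w j : ℤ) - u j) = 0
    · have : w = u := funext fun j => by
        have := congrFun h0 j
        simp only [Pi.zero_apply] at this
        omega
      rw [this]
    · obtain ⟨g, hg, hc⟩ := exists_mem_graverBasis_conforms A hwu h0
      have ht : ∀ j, (((w j : ℤ) - g j).toNat : ℤ) = w j - g j := fun j => by
        have := hc j
        simp only at this
        omega
      have hlt : ∑ j, ((((w j : ℤ) - g j).toNat : ℤ) - u j).natAbs < N := by
        rw [← hN]
        obtain ⟨j, hj⟩ := Function.ne_iff.mp hg.2.1
        rw [Pi.zero_apply] at hj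
        refine Finset.sum_lt_sum (fun i _ => ?_) ⟨j, Finset.mem_univ j, ?_⟩
        · have := hc i
          simp only at this
          rw [ht]
          omega
        · have := hc j
          simp only at this
          rw [ht]
          omega
      refine Relation.ReflTransGen.head ⟨g, hg, Or.inl fun j => ?_⟩
        (ih _ hlt (fun j => ((w j : ℤ) - g j).toNat) ?_ rfl)
      · rw [ht]; ring
      · have : (fun j => (((w j : ℤ) - g j).toNat : ℤ) - u j) =
            (fun j => (w j : ℤ) - u j) - g := funext fun j => by
          rw [ht, Pi.sub_apply]; ring
        rw [this]
        exact sub_mem hwu hg.1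

/-- Guarantees that a vector forced into every Markov basis really lies in the universal one. -/
theorem exists_isMinimalMarkovBasis (A : Matrix ι κ ℕ) :
    ∃ M : Set (κ → ℤ), IsMinimalMarkovBasis A M := by
  have hfin : {M : Set (κ → ℤ) | M ⊆ graverBasis A ∧ IsMarkovBasis A M}.Finite :=
    (graverBasis_finite A).finite_subsets.subset fun M hM => hM.1
  obtain ⟨M, hM⟩ := hfin.exists_minimal ⟨_, subset_rfl, graverBasis_isMarkovBasis A⟩
  exact ⟨M, hM.prop.2, fun N hN hNM => hM.le_of_le ⟨hNM.trans hM.prop.1, hN⟩ hNM⟩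

/-- If a fiber has exactly two elements, then every Markov basis contains their difference, up
to sign. -/
theorem IsMarkovBasis.sub_mem_or {A : Matrix ι κ ℕ} {M : Set (κ → ℤ)} (hM : IsMarkovBasis A M)
    {w u : κ → ℕ} (hne : w ≠ u) (hwu : (fun j => (w j : ℤ) - u j) ∈ kerLattice A)
    (hfib : ∀ t : κ → ℕ, (fun j => (w j : ℤ) - t j) ∈ kerLattice A → t = w ∨ t = u) :
    (fun j => (w j : ℤ) - u j) ∈ M ∨ (fun j => -((w j : ℤ) - u j)) ∈ M := by
  by_contra hcon
  push Not at hcon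
  -- A walk cannot leave w: its first step away would land on u, so the move used would be ±(w - u).
  have key : ∀ t, Relation.ReflTransGen (Move M) w t → t = w := fun t ht => by
    induction ht with
    | refl => rfl
    | @tail s t _ hst hs =>
      subst hs
      obtain ⟨v, hv, h⟩ := hst
      have hmem : (fun j => (s j : ℤ) - t j) ∈ kerLattice A := by
        rcases h with h | h
        · rw [funext h]; exact hM.2.1 hv
        · rw [funext h]; exact neg_mem (hM.2.1 hv)
      rcases hfib t hmem with rfl | rfl
      · rfl
      · rcases h with h | h
        · exact absurd (by rw [funext h]; exact hv) hcon.1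
        · refine absurd ?_ hcon.2
          rw [show (fun j => -((s j : ℤ) - t j)) = v from funext fun j => by rw [h j, neg_neg]]
          exact hv
  exact hne (key u (hM.2.2 w u hwu)).symm

/-! ### Lawrence liftings and the vector of type 3. -/

theorem mem_kerLattice_lawrenceLifting {ι κ : Type*} [Fintype κ] [DecidableEq κ]
    (A : Matrix ι κ ℕ) (r : ℕ) (u : Fin r × κ → ℤ) :
    u ∈ kerLattice (lawrenceLifting A r) ↔
      (∀ p, (fun j => u (p, j)) ∈ kerLattice A) ∧ ∀ j, ∑ p, u (p, j) = 0 := by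
  change (_ = _) ↔ (∀ p, _ = _) ∧ _
  simp only [funext_iff, Matrix.mulVec, dotProduct, Sum.forall, Prod.forall, Pi.zero_apply,
    Fintype.sum_prod_type]
  refine and_congr (forall₂_congr fun p i => ?_) (forall_congr' fun j => ?_)
  · rw [Finset.sum_eq_single p] <;> simp +contextual [lawrenceLifting, eq_comm]
  · simp [lawrenceLifting]

theorem mem_kerLattice_curveMatrix {m : ℕ} (l : Fin m → ℕ) (u : Fin m → ℤ) :
    u ∈ kerLattice (curveMatrix l) ↔ ∑ j, (l j : ℤ) * u j = 0 := by
  change (_ = _) ↔ _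
  simp [funext_iff, Matrix.mulVec, dotProduct, curveMatrix]

/-- If the least multiples of three of the weights are pairwise different, then the universal
Markov basis of the third Lawrence lifting contains an element of type `3`. -/
theorem three_le_markovComplexity {m : ℕ} (l : Fin m → ℕ) (hl : ∀ i, 0 < l i)
    {i₁ i₂ i₃ : Fin m} (hi₁₂ : i₁ ≠ i₂) (hi₁₃ : i₁ ≠ i₃) (hi₂₃ : i₂ ≠ i₃) {c₁ c₂ c₃ : ℕ}
    (h₁ : IsLeastMultiple (l i₂) (l i₃) (l i₁) c₁) (h₂ : IsLeastMultiple (l i₁) (l i₃) (l i₂) c₂)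
    (h₃ : IsLeastMultiple (l i₁) (l i₂) (l i₃) c₃) (h₁₂ : c₁ * l i₁ ≠ c₂ * l i₂)
    (h₁₃ : c₁ * l i₁ ≠ c₃ * l i₃) (h₂₃ : c₂ * l i₂ ≠ c₃ * l i₃) :
    3 ≤ markovComplexity (curveMatrix l) := by
  obtain ⟨r₁₂, r₁₃, r₂₁, r₂₃, r₃₁, r₃₂, hr, hs, u₁, u₂, u₃⟩ :=
    exists_herzog_relations (hl i₁) (hl i₂) (hl i₃) h₁ h₂ h₃ h₁₂ h₁₃ h₂₃
  have hc₁ := h₁.pos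
  let e : Fin 3 → Fin m := ![i₁, i₂, i₃]
  have he : Function.Injective e := by
    intro a b hab
    fin_cases a <;> fin_cases b <;> simp_all [e]
  -- The rows of D - R are Herzog's three relations; its columns sum to zero since r₂₁ + r₃₁ = c₁,
  -- and so on. `ext` pads with zero columns.
  let D : Fin 3 → Fin 3 → ℕ := ![![c₁, 0, 0], ![0, c₂, 0], ![0, 0, c₃]]
  let R : Fin 3 → Fin 3 → ℕ := ![![0, r₁₂, r₁₃], ![r₂₁, 0, r₂₃], ![r₃₁, r₃₂, 0]]
  let ext : (Fin 3 → Fin 3 → ℕ) → Fin 3 × Fin m → ℕ :=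
    fun T x => Function.extend e (T x.1) 0 x.2
  have ext_e : ∀ T p q, ext T (p, e q) = T p q := fun T p q => he.extend_apply _ _ _
  have ext_not : ∀ T p j, (¬ ∃ q, e q = j) → ext T (p, j) = 0 := fun T p j hj => by
    simp [ext, Function.extend_apply' _ _ _ hj]
  have mem : ∀ S T : Fin 3 → Fin 3 → ℕ,
      (fun x => (ext S x : ℤ) - ext T x) ∈ kerLattice (lawrenceLifting (curveMatrix l) 3) ↔
      (∀ p, ∑ q, (l (e q) : ℤ) * ((S p q : ℤ) - T p q) = 0) ∧
        ∀ q, ∑ p, ((S p q : ℤ) - T p q) = 0 := fun S T => by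
    rw [mem_kerLattice_lawrenceLifting]
    simp only [mem_kerLattice_curveMatrix]
    refine and_congr (forall_congr' fun p => ?_) ⟨fun h q => ?_, fun h j => ?_⟩
    · rw [Fintype.sum_of_injective e he (fun q => (l (e q) : ℤ) * ((S p q : ℤ) - T p q))
        (fun j => (l j : ℤ) * ((ext S (p, j) : ℤ) - ext T (p, j)))]
      · intro j hj
        have hj' : ¬ ∃ q, e q = j := hj
        simp [ext_not _ _ _ hj']
      · intro q
        simp only [ext_e]
    · simpa only [ext_e] using h (e q)
    · by_cases hj : ∃ q, e q = j
      · obtain ⟨q, rfl⟩ := hj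
        simpa only [ext_e] using h q
      · simp [ext_not _ _ _ hj]
  have v₁ := (u₁ r₁₂ r₁₃).2 ⟨rfl, rfl⟩
  have v₂ := (u₂ r₂₁ r₂₃).2 ⟨rfl, rfl⟩
  have v₃ := (u₃ r₃₁ r₃₂).2 ⟨rfl, rfl⟩
  have hker : (fun x => (ext D x : ℤ) - ext R x) ∈
      kerLattice (lawrenceLifting (curveMatrix l) 3) := by
    zify at v₁ v₂ v₃
    rw [mem]
    simp only [Fin.forall_fin_succ, Fin.sum_univ_three, IsEmpty.forall_iff, and_true]
    simp [D, R, e]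
    refine ⟨⟨?_, ?_, ?_⟩, ?_⟩
    · linarith
    · linarith
    · linarith
    · omega
  have hne : ext D ≠ ext R := fun h => by
    have := congrFun h (0, e 0)
    rw [ext_e, ext_e] at this
    simp [D, R] at this
    omega
  have hfib : ∀ t : Fin 3 × Fin m → ℕ,
      (fun x => (ext D x : ℤ) - t x) ∈ kerLattice (lawrenceLifting (curveMatrix l) 3) →
      t = ext D ∨ t = ext R := fun t ht => by
    obtain ⟨T, hT⟩ : ∃ T : Fin 3 → Fin 3 → ℕ, ∀ p q, T p q = t (p, e q) := ⟨_, fun _ _ => rfl⟩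
    have htT : t = ext T := by
      refine funext fun ⟨p, j⟩ => ?_
      by_cases hj : ∃ q, e q = j
      · obtain ⟨q, rfl⟩ := hj
        rw [ext_e, hT]
      · rw [ext_not T p j hj]
        -- In a column where D vanishes, the nonnegative entries of t sum to zero.
        have := ((mem_kerLattice_lawrenceLifting _ _ _).1 ht).2 j
        simp only [ext_not _ _ _ hj, Nat.cast_zero, zero_sub, Finset.sum_neg_distrib,
          neg_eq_zero] at this
        have h0 := (Finset.sum_eq_zero_iff_of_nonneg (fun _ _ => by positivity)).1 this p
          (Finset.mem_univ p)
        exact_mod_cast h0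
    clear hT
    subst htT
    rw [mem] at ht
    simp only [Fin.forall_fin_succ, Fin.sum_univ_three, IsEmpty.forall_iff, and_true] at ht
    simp [D, e] at ht
    obtain ⟨⟨w₁, w₂, w₃⟩, s₁, s₂, s₃⟩ := ht
    have x₁ := h₁.eq_or_eq_zero (hl i₁) (hl i₂) (hl i₃) (a := T 0 0) (b := T 0 1) (d := T 0 2)
      (by zify; linarith)
    have x₂ := h₂.eq_or_eq_zero (hl i₂) (hl i₁) (hl i₃) (a := T 1 1) (b := T 1 0) (d := T 1 2)
      (by zify; linarith)
    have x₃ := h₃.eq_or_eq_zero (hl i₃) (hl i₁) (hl i₂) (a := T 2 2) (b := T 2 0) (d := T 2 1)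
      (by zify; linarith)
    rw [u₁] at x₁
    rw [u₂] at x₂
    rw [u₃] at x₃
    -- Each row of T is the corresponding row of D or of R. One row from D already exhausts its
    -- column sum cᵢ, and as all rⱼᵢ > 0 this forces the other rows to come from D too.
    have hT : T = D ∨ T = R := by
      simp only [funext_iff, Fin.forall_fin_succ, IsEmpty.forall_iff, and_true]
      simp [D, R]
      omega
    rcases hT with rfl | rfl
    · exact Or.inl rfl
    · exact Or.inr rfl
  obtain ⟨M, hM⟩ := exists_isMinimalMarkovBasis (lawrenceLifting (curveMatrix l) 3)
  have hle : ∀ v ∈ M, (∀ p, ∃ j, v (p, j) ≠ 0) → 3 ≤ markovComplexity (curveMatrix l) :=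
    fun v hv hv0 => by
      have htype : type v = 3 := by
        rw [type, Set.eq_univ_of_forall (s := {p : Fin 3 | ∃ j, v (p, j) ≠ 0}) hv0,
          Set.ncard_univ, Nat.card_fin]
      refine le_trans (by rw [htype]; rfl) (le_iSup_of_le 3 (le_iSup_of_le (by norm_num)
        (le_iSup_of_le v (le_iSup_of_le ⟨M, hM, hv⟩ (le_refl (type v : ℕ∞))))))
  have hc₂ := h₂.pos
  have hc₃ := h₃.pos
  have hrow : ∀ p, (ext D (p, e p) : ℤ) - ext R (p, e p) ≠ 0 := fun p => by
    rw [ext_e, ext_e]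
    fin_cases p <;> simp [D, R] <;> omega
  rcases hM.prop.sub_mem_or hne hker hfib with h | h
  · exact hle _ h fun p => ⟨e p, hrow p⟩
  · exact hle _ h fun p => ⟨e p, neg_ne_zero.2 (hrow p)⟩

/-! ### Binomials in toric ideals, and their height. -/

section Toric

open MvPolynomial

variable {k : Type*} [Field k] {ι κ : Type*} [Fintype ι]

instance toricIdeal_isPrime (A : Matrix ι κ ℕ) : (toricIdeal k A).IsPrime :=
  RingHom.ker_isPrime _

variable [Fintype κ]

/-- The weight of an exponent vector with respect to the rows of `A`. -/
noncomputable def weight (A : Matrix ι κ ℕ) (u : κ →₀ ℕ) : ι →₀ ℕ :=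
  Finsupp.equivFunOnFinite.symm (A.mulVec u)

theorem weight_apply (A : Matrix ι κ ℕ) (u : κ →₀ ℕ) (i : ι) :
    weight A u i = ∑ j, A i j * u j := rfl

theorem aeval_monomial_eq_weight (A : Matrix ι κ ℕ) (u : κ →₀ ℕ) (a : k) :
    aeval (R := k) (fun j : κ => ∏ i : ι, (X i : MvPolynomial ι k) ^ A i j) (monomial u a) =
      monomial (weight A u) a := by
  rw [aeval_monomial, monomial_eq, Finsupp.prod_fintype _ _ (by simp),
    Finsupp.prod_fintype _ _ (by simp)]
  simp only [← Finset.prod_pow]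
  rw [Finset.prod_comm, algebraMap_eq]
  congr 1
  refine Finset.prod_congr rfl fun i _ => ?_
  simp only [← pow_mul]
  rw [Finset.prod_pow_eq_pow_sum, weight_apply]

theorem monomial_sub_monomial_mem_toricIdeal {A : Matrix ι κ ℕ} {u v : κ →₀ ℕ}
    (h : weight A u = weight A v) :
    (monomial u 1 - monomial v 1 : MvPolynomial κ k) ∈ toricIdeal k A := by
  rw [toricIdeal, RingHom.mem_ker, map_sub]
  erw [aeval_monomial_eq_weight, aeval_monomial_eq_weight]
  rw [h, sub_self]

theorem monomial_sub_monomial_notMem_toricIdeal {A : Matrix ι κ ℕ} {u v : κ →₀ ℕ}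
    (h : weight A u ≠ weight A v) :
    (monomial u 1 - monomial v 1 : MvPolynomial κ k) ∉ toricIdeal k A := by
  rw [toricIdeal, RingHom.mem_ker, map_sub]
  erw [aeval_monomial_eq_weight, aeval_monomial_eq_weight]
  intro h0
  exact h (monomial_left_injective one_ne_zero (sub_eq_zero.1 h0))

/-- A toric ideal is contained in every ideal that contains its binomials. -/
theorem toricIdeal_le {A : Matrix ι κ ℕ} {J : Ideal (MvPolynomial κ k)}
    (h : ∀ u v : κ →₀ ℕ, weight A u = weight A v →
      (monomial u 1 - monomial v 1 : MvPolynomial κ k) ∈ J) : toricIdeal k A ≤ J := by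
  classical
  -- σ picks one monomial per attained weight. The induced linear map ψ, composed with the
  -- parametrization, is the quotient map modulo J, so the kernel lies in J.
  let σ : (ι →₀ ℕ) → (κ →₀ ℕ) := fun w => if hw : ∃ u, weight A u = w then hw.choose else 0
  have hσ : ∀ u, weight A (σ (weight A u)) = weight A u := fun u => by
    have hw : ∃ v, weight A v = weight A u := ⟨u, rfl⟩
    simp only [σ, dif_pos hw]
    exact hw.choose_spec
  let ψ : MvPolynomial ι k →ₗ[k] MvPolynomial κ k ⧸ J :=
    (basisMonomials ι k).constr k fun w => Ideal.Quotient.mk J (monomial (σ w) 1)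
  have hψ : ∀ w, ψ (monomial w 1) = Ideal.Quotient.mk J (monomial (σ w) 1) := fun w => by
    have := (basisMonomials ι k).constr_basis k
      (fun w => Ideal.Quotient.mk J (monomial (σ w) (1 : k))) w
    rwa [coe_basisMonomials] at this
  let φ := aeval (R := k) (fun j : κ => ∏ i : ι, (X i : MvPolynomial ι k) ^ A i j)
  have key : ψ ∘ₗ φ.toLinearMap = (Ideal.Quotient.mkₐ k J).toLinearMap := by
    refine linearMap_ext fun u => LinearMap.ext_ring ?_
    simp only [LinearMap.comp_apply, AlgHom.toLinearMap_apply]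
    rw [aeval_monomial_eq_weight, hψ, Ideal.Quotient.mkₐ_eq_mk]
    exact Ideal.Quotient.eq.2 (h _ _ (hσ u))
  intro f hf
  have hf' : φ f = 0 := hf
  have := LinearMap.congr_fun key f
  simp only [LinearMap.comp_apply, AlgHom.toLinearMap_apply, hf', map_zero] at this
  exact Ideal.Quotient.eq_zero_iff_mem.1 this.symm

theorem weight_curveMatrix_eq_iff {m : ℕ} (n : Fin m → ℕ) (u v : Fin m →₀ ℕ) :
    weight (curveMatrix n) u = weight (curveMatrix n) v ↔
      ∑ j, n j * u j = ∑ j, n j * v j := by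
  simp [Finsupp.ext_iff, weight_apply, curveMatrix]

/-- The toric ideal of a monomial curve in the three-dimensional affine space has height at
least two. -/
theorem two_le_height_toricIdeal (n : Fin 3 → ℕ) (hn : ∀ i, 0 < n i) :
    2 ≤ (toricIdeal k (curveMatrix n)).height := by
  -- Grading the third variable separately yields a prime strictly between 0 and the toric ideal of
  -- the curve.
  let B : Matrix (Fin 2) (Fin 3) ℕ := !![n 0, n 1, 0; 0, 0, 1]
  have hB : ∀ u v : Fin 3 →₀ ℕ, weight B u = weight B v ↔
      n 0 * u 0 + n 1 * u 1 = n 0 * v 0 + n 1 * v 1 ∧ u 2 = v 2 := fun u v => by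
    simp [Finsupp.ext_iff, weight_apply, B, Fin.sum_univ_three, Fin.forall_fin_two]
  have h₁ : (⊥ : Ideal (MvPolynomial (Fin 3) k)) < toricIdeal k B := by
    refine bot_lt_iff_ne_bot.2 fun h => ?_
    have hm := monomial_sub_monomial_mem_toricIdeal (k := k) (A := B)
      (u := Finsupp.single 0 (n 1)) (v := Finsupp.single 1 (n 0)) (by
        rw [hB]
        simp [mul_comm])
    rw [h, Ideal.mem_bot, sub_eq_zero] at hm
    have := DFunLike.congr_fun (monomial_left_injective one_ne_zero hm) 0
    simp [(hn 1).ne'] at this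
  have h₂ : toricIdeal k B < toricIdeal k (curveMatrix n) := by
    refine lt_of_le_of_ne (toricIdeal_le fun u v huv => ?_) fun h => ?_
    · refine monomial_sub_monomial_mem_toricIdeal ?_
      rw [hB] at huv
      rw [weight_curveMatrix_eq_iff, Fin.sum_univ_three, Fin.sum_univ_three, huv.1, huv.2]
    · have hm := monomial_sub_monomial_mem_toricIdeal (k := k) (A := curveMatrix n)
        (u := Finsupp.single 0 (n 2)) (v := Finsupp.single 2 (n 0)) (by
          rw [weight_curveMatrix_eq_iff]
          simp [Fin.sum_univ_three, mul_comm])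
      rw [← h] at hm
      refine monomial_sub_monomial_notMem_toricIdeal ?_ hm
      rw [Ne, hB]
      simp [(hn 0).ne, (hn 0).ne', (hn 2).ne']
  have e₁ := Ideal.height_add_one_le_of_lt_of_isPrime h₁
  have e₂ := Ideal.height_add_one_le_of_lt_of_isPrime h₂
  rw [Ideal.height_bot, zero_add] at e₁
  calc (2 : ℕ∞) = 1 + 1 := by norm_num
    _ ≤ (toricIdeal k B).height + 1 := by gcongr
    _ ≤ _ := e₂

/-- A prime ideal of height at least two generated by two elements is a complete
intersection. -/
theorem isCompleteIntersection_of_span_pair {R : Type*} [CommRing R] [IsNoetherianRing R]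
    {I : Ideal R} [I.IsPrime] (hI : 2 ≤ I.height) {f g : R} (h : Ideal.span {f, g} = I) :
    IsCompleteIntersection I := by
  classical
  have hs : Ideal.span (({f, g} : Finset R) : Set R) = I := by
    rw [← h]; simp
  refine ⟨{f, g}, hs, le_antisymm ?_ ?_⟩
  -- Card ≤ 2 ≤ height, and Krull's height theorem gives the reverse bound; f ≠ g need not be known.
  · refine le_trans ?_ hI
    exact_mod_cast Finset.card_le_two
  · refine Ideal.height_le_card_of_mem_minimalPrimes_span_finset ?_
    rw [hs, Ideal.minimalPrimes_eq_subsingleton_self]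
    rfl

end Toric

/-! ### Normal forms when two least multiples coincide. -/

/-- Normal forms of the monomials modulo `x ^ c₁ = y ^ c₂` and `z ^ c₃ = x ^ a * y ^ b`. -/
theorem exists_normal_form {R : Type*} [CommRing R] {x y z : R} {n₁ n₂ n₃ c₁ c₂ c₃ a b : ℕ}
    (hc₂ : 0 < c₂) (hc₃ : 0 < c₃) (hxy : x ^ c₁ = y ^ c₂) (hz : z ^ c₃ = x ^ a * y ^ b)
    (e : c₁ * n₁ = c₂ * n₂) (e₃ : c₃ * n₃ = a * n₁ + b * n₂) (p q s : ℕ) :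
    ∃ p' q' s' : ℕ, q' < c₂ ∧ s' < c₃ ∧
      n₁ * p + n₂ * q + n₃ * s = n₁ * p' + n₂ * q' + n₃ * s' ∧
      x ^ p * y ^ q * z ^ s = x ^ p' * y ^ q' * z ^ s' := by
  -- Replace z^c₃ by x^a y^b d times, then y^c₂ by x^c₁ f times; the exponent of x stays unbounded.
  have hs := Nat.div_add_mod s c₃
  set d := s / c₃
  have hq := Nat.div_add_mod (q + b * d) c₂
  set f := (q + b * d) / c₂
  refine ⟨p + a * d + c₁ * f, (q + b * d) % c₂, s % c₃, Nat.mod_lt _ hc₂, Nat.mod_lt _ hc₃,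
    ?_, ?_⟩
  · zify at *
    linear_combination (-n₃ : ℤ) * hs + d * e₃ - f * e - n₂ * hq
  · calc x ^ p * y ^ q * z ^ s = x ^ p * y ^ q * (z ^ c₃) ^ d * z ^ (s % c₃) := by
          conv_lhs => rw [← hs]
          ring
      _ = x ^ (p + a * d) * y ^ (q + b * d) * z ^ (s % c₃) := by rw [hz]; ring
      _ = x ^ (p + a * d) * (y ^ c₂) ^ f * y ^ ((q + b * d) % c₂) * z ^ (s % c₃) := by
          conv_lhs => rw [← hq]
          ring
      _ = _ := by rw [← hxy]; ring

/-- Normal forms of the same weight coincide. -/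
theorem normal_form_unique {n₁ n₂ n₃ c₁ c₂ c₃ : ℕ} (hn₁ : 0 < n₁) (hn₂ : 0 < n₂) (hn₃ : 0 < n₃)
    (h₁ : IsLeastMultiple n₂ n₃ n₁ c₁) (h₂ : IsLeastMultiple n₁ n₃ n₂ c₂)
    (h₃ : IsLeastMultiple n₁ n₂ n₃ c₃) (e : c₁ * n₁ = c₂ * n₂) {p q s p' q' s' : ℕ}
    (hq : q < c₂) (hs : s < c₃) (hq' : q' < c₂) (hs' : s' < c₃)
    (hw : n₁ * p + n₂ * q + n₃ * s = n₁ * p' + n₂ * q' + n₃ * s') :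
    p = p' ∧ q = q' ∧ s = s' := by
  wlog hle : s' ≤ s generalizing p q s p' q' s'
  · have := this hq' hs' hq hs hw.symm (le_of_not_ge hle)
    omega
  have e' : (c₁ * n₁ : ℤ) = c₂ * n₂ := by exact_mod_cast e
  have hw' : (n₁ * p + n₂ * q + n₃ * s : ℤ) = n₁ * p' + n₂ * q' + n₃ * s' := by
    exact_mod_cast hw
  have hle' : (0 : ℤ) ≤ (s : ℤ) - s' := by omega
  have hqq : q' ≤ q := by
    by_contra hlt
    rcases le_or_gt p' p with hp | hp
    · have := h₂.le (x := (q' : ℤ) - q) (y := (p : ℤ) - p') (z := (s : ℤ) - s') (by omega)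
        (by omega) hle' (by linear_combination -hw')
      omega
    · have hlt' : (0 : ℤ) < (q' : ℤ) - q := by omega
      have hp' : (0 : ℤ) ≤ (p' : ℤ) - p := by omega
      rcases hle'.eq_or_lt with h0 | h0
      · have : (0 : ℤ) < ((p' : ℤ) - p) * n₁ + ((q' : ℤ) - q) * n₂ := by positivity
        have : ((p' : ℤ) - p) * n₁ + ((q' : ℤ) - q) * n₂ = ((s : ℤ) - s') * n₃ := by
          linear_combination -hw'
        rw [← h0] at this
        omega
      · have := h₃.le (x := (s : ℤ) - s') (y := (p' : ℤ) - p) (z := (q' : ℤ) - q) h0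
          hp' hlt'.le (by linear_combination hw')
        omega
  have hqq' : (0 : ℤ) ≤ (q : ℤ) - q' := by omega
  have hpp : p' ≤ p := by
    by_contra hlt
    have hc := h₁.le (x := (p' : ℤ) - p) (y := (q : ℤ) - q') (z := (s : ℤ) - s') (by omega)
      hqq' hle' (by linear_combination -hw')
    rcases hle'.eq_or_lt with h0 | h0
    · have key : ((q : ℤ) - q') * n₂ = ((p' : ℤ) - p) * n₁ := by
        linear_combination hw' + n₃ * h0
      have hpos : (0 : ℤ) < ((q : ℤ) - q') * n₂ := by
        rw [key]
        have : (0 : ℤ) < (p' : ℤ) - p := by omega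
        positivity
      have := h₂.le (x := (q : ℤ) - q') (y := (p' : ℤ) - p) (z := 0)
        (pos_of_mul_pos_left hpos (by omega)) (by omega) le_rfl (by linear_combination key)
      omega
    -- Since p' - p ≥ c₁, trading c₁n₁ for c₂n₂ makes both coefficients nonnegative, and 0 < s - s'
    -- < c₃ contradicts minimality.
    · have := h₃.le (x := (s : ℤ) - s') (y := (p' : ℤ) - p - c₁) (z := (c₂ : ℤ) - (q - q')) h0
        (by omega) (by omega) (by linear_combination hw' + e')
      omega
  have t₁ := Nat.mul_le_mul_left n₁ hpp
  have t₂ := Nat.mul_le_mul_left n₂ hqq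
  have t₃ := Nat.mul_le_mul_left n₃ hle
  refine ⟨?_, ?_, ?_⟩
  · exact Nat.eq_of_mul_eq_mul_left hn₁ (by omega)
  · exact Nat.eq_of_mul_eq_mul_left hn₂ (by omega)
  · exact Nat.eq_of_mul_eq_mul_left hn₃ (by omega)

open MvPolynomial in
/-- If two of the least multiples coincide, then the toric ideal is a complete intersection. -/
theorem isCompleteIntersection_of_eq (k : Type*) [Field k] (n : Fin 3 → ℕ) (hn : ∀ i, 0 < n i)
    {i₁ i₂ i₃ : Fin 3} (hi₁₂ : i₁ ≠ i₂) (hi₁₃ : i₁ ≠ i₃) (hi₂₃ : i₂ ≠ i₃) {c₁ c₂ c₃ : ℕ}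
    (h₁ : IsLeastMultiple (n i₂) (n i₃) (n i₁) c₁) (h₂ : IsLeastMultiple (n i₁) (n i₃) (n i₂) c₂)
    (h₃ : IsLeastMultiple (n i₁) (n i₂) (n i₃) c₃) (e : c₁ * n i₁ = c₂ * n i₂) :
    IsCompleteIntersection (toricIdeal k (curveMatrix n)) := by
  obtain ⟨a, b, e₃⟩ := h₃.exists_eq
  have huniv : (Finset.univ : Finset (Fin 3)) = {i₁, i₂, i₃} := by
    clear h₁ h₂ h₃ e e₃
    revert i₁ i₂ i₃
    decide
  have hsum : ∀ u : Fin 3 →₀ ℕ, ∑ j, n j * u j = n i₁ * u i₁ + n i₂ * u i₂ + n i₃ * u i₃ :=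
    fun u => by
      rw [huniv, Finset.sum_insert (by simp [hi₁₂, hi₁₃]), Finset.sum_pair hi₂₃, add_assoc]
  have hmon : ∀ u : Fin 3 →₀ ℕ, (monomial u 1 : MvPolynomial (Fin 3) k) =
      X i₁ ^ u i₁ * X i₂ ^ u i₂ * X i₃ ^ u i₃ := fun u => by
    rw [monomial_eq, Finsupp.prod_fintype _ _ (by simp), huniv,
      Finset.prod_insert (by simp [hi₁₂, hi₁₃]), Finset.prod_pair hi₂₃, C_1, one_mul, mul_assoc]
  have hbin : ∀ u v : Fin 3 →₀ ℕ,
      n i₁ * u i₁ + n i₂ * u i₂ + n i₃ * u i₃ = n i₁ * v i₁ + n i₂ * v i₂ + n i₃ * v i₃ →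
      (X i₁ ^ u i₁ * X i₂ ^ u i₂ * X i₃ ^ u i₃ - X i₁ ^ v i₁ * X i₂ ^ v i₂ * X i₃ ^ v i₃ :
        MvPolynomial (Fin 3) k) ∈ toricIdeal k (curveMatrix n) := fun u v h => by
    rw [← hmon, ← hmon]
    refine monomial_sub_monomial_mem_toricIdeal ?_
    rw [weight_curveMatrix_eq_iff, hsum, hsum, h]
  refine isCompleteIntersection_of_span_pair (two_le_height_toricIdeal n hn)
    (f := X i₁ ^ c₁ - X i₂ ^ c₂) (g := X i₃ ^ c₃ - X i₁ ^ a * X i₂ ^ b) (le_antisymm ?_ ?_)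
  · rw [Ideal.span_le, Set.insert_subset_iff, Set.singleton_subset_iff]
    constructor
    · have := hbin (Finsupp.single i₁ c₁) (Finsupp.single i₂ c₂) (by
        simp [hi₁₂, hi₁₃, hi₂₃, hi₁₂.symm]
        linarith)
      simpa [hi₁₂, hi₁₃, hi₂₃, hi₁₂.symm] using this
    · have := hbin (Finsupp.single i₃ c₃) (Finsupp.single i₁ a + Finsupp.single i₂ b) (by
        simp [hi₁₂, hi₁₃, hi₂₃, hi₁₂.symm, hi₁₃.symm, hi₂₃.symm]
        linarith)
      simpa [hi₁₂, hi₁₃, hi₂₃, hi₁₂.symm, hi₁₃.symm, hi₂₃.symm] using this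
  · refine toricIdeal_le fun u v huv => ?_
    rw [weight_curveMatrix_eq_iff, hsum, hsum] at huv
    set J : Ideal (MvPolynomial (Fin 3) k) :=
      Ideal.span {X i₁ ^ c₁ - X i₂ ^ c₂, X i₃ ^ c₃ - X i₁ ^ a * X i₂ ^ b}
    let π := Ideal.Quotient.mk J
    have hxy : π (X i₁) ^ c₁ = π (X i₂) ^ c₂ := by
      rw [← map_pow, ← map_pow]
      exact Ideal.Quotient.eq.2 (Ideal.subset_span (by simp))
    have hz : π (X i₃) ^ c₃ = π (X i₁) ^ a * π (X i₂) ^ b := by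
      rw [← map_pow, ← map_pow, ← map_pow, ← map_mul]
      exact Ideal.Quotient.eq.2 (Ideal.subset_span (by simp))
    obtain ⟨p, q, s, hq, hs, hw, hm⟩ :=
      exists_normal_form h₂.pos h₃.pos hxy hz e e₃ (u i₁) (u i₂) (u i₃)
    obtain ⟨p', q', s', hq', hs', hw', hm'⟩ :=
      exists_normal_form h₂.pos h₃.pos hxy hz e e₃ (v i₁) (v i₂) (v i₃)
    -- Monomials of equal weight have the same normal form, hence are congruent modulo J.
    obtain ⟨rfl, rfl, rfl⟩ := normal_form_unique (hn i₁) (hn i₂) (hn i₃) h₁ h₂ h₃ e hq hs hq' hs'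
      (hw.symm.trans (huv.trans hw'))
    refine Ideal.Quotient.eq.1 ?_
    rw [hmon, hmon]
    simpa only [map_mul, map_pow] using hm.trans hm'.symm

end MarkovBases

theorem corollary2p5 (k : Type*) [Field k] (m : ℕ) (l : Fin m → ℕ) (hl : ∀ i, 0 < l i)
    (hA : MarkovBases.markovComplexity (MarkovBases.curveMatrix l) = 2)
    (i₁ i₂ i₃ : Fin m) :
    MarkovBases.IsCompleteIntersection
      (MarkovBases.toricIdeal k (MarkovBases.curveMatrix ![l i₁, l i₂, l i₃])) := by
  open MarkovBases in
  obtain ⟨c₁, h₁⟩ := IsLeastMultiple.exists_of_pos (p := l i₂) (q := l i₃) (n := l i₁) (hl i₂)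
  obtain ⟨c₂, h₂⟩ := IsLeastMultiple.exists_of_pos (p := l i₁) (q := l i₃) (n := l i₂) (hl i₁)
  obtain ⟨c₃, h₃⟩ := IsLeastMultiple.exists_of_pos (p := l i₁) (q := l i₂) (n := l i₃) (hl i₁)
  have hn : ∀ i, 0 < ![l i₁, l i₂, l i₃] i := by
    simp [Fin.forall_fin_succ, hl]
  by_cases h₁₂ : c₁ * l i₁ = c₂ * l i₂
  · exact isCompleteIntersection_of_eq k _ hn (i₁ := 0) (i₂ := 1) (i₃ := 2) (by decide)
      (by decide) (by decide) h₁ h₂ h₃ h₁₂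
  by_cases h₁₃ : c₁ * l i₁ = c₃ * l i₃
  · exact isCompleteIntersection_of_eq k _ hn (i₁ := 0) (i₂ := 2) (i₃ := 1) (by decide)
      (by decide) (by decide) h₁.symm h₃ h₂ h₁₃
  by_cases h₂₃ : c₂ * l i₂ = c₃ * l i₃
  · exact isCompleteIntersection_of_eq k _ hn (i₁ := 1) (i₂ := 2) (i₃ := 0) (by decide)
      (by decide) (by decide) h₂.symm h₃.symm h₁ h₂₃
  -- Equal indices would make both least multiples 1, a case already settled.
  have hi₁₂ : i₁ ≠ i₂ := by
    rintro rfl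
    exact h₁₂ (by rw [h₁.eq_one, h₂.eq_one])
  have hi₁₃ : i₁ ≠ i₃ := by
    rintro rfl
    exact h₁₃ (by rw [h₁.symm.eq_one, h₃.eq_one])
  have hi₂₃ : i₂ ≠ i₃ := by
    rintro rfl
    exact h₂₃ (by rw [h₂.symm.eq_one, h₃.symm.eq_one])
  have h := three_le_markovComplexity l hl hi₁₂ hi₁₃ hi₂₃ h₁ h₂ h₃ h₁₂ h₁₃ h₂₃
  rw [hA] at h
  exact absurd h (by decide)
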